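/- Let $Q=\bowtie_{R\in\sigma}R(A_R)$ be a join query, where $\sigma$ is a finite set of relation names and each relation name $R\in\sigma$ has a finite set $A_R$ of attributes; let $A=\bigcup_{R\in\sigma}A_R$ and assume $n=|A|\ge 1$. For an instance $D$ with domain $[N]$ (a set $R(D)\subseteq[N]^{A_R}$ for every $R\in\sigma$), the answer $Q(D)$ is the set of all $t\in[N]^A$ whose restriction to $A_R$ belongs to $R(D)$ for every $R\in\sigma$. For every $R\in\sigma$ let $p_R:\mathbb N\to(0,1)$, and let $D$ be the random instance with domain $[N]$ in which each tuple $t\in[N]^{A_R}$ is placed in $R(D)$ with probability $p_R(N)$, independently for all $R$ and all $t$. Let $X=|Q(D)|$. Let $$\delta(N)=\max_{\emptyset\ne B\subseteq A}\ \frac1{|B|}\sum_{R\in\sigma:\,A_R\subseteq B}\log_2\frac1{p_R(N)}$$ be the maximum density of $Q$. All logarithms are base $2$, and $f=\omega(g)$ means that for every $C>0$ we have $f(N)>C\,g(N)$ for all large enough $N$. 1. Assume that every $A_R$ is non-empty. If $\delta(N)=\log N-\omega(\log\log N)$, then $X\sim N^n\prod_{R\in\sigma}p_R(N)$ polynomially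 almost surely; that is, with $x_N=N^n\prod_{R\in\sigma}p_R(N)$, for every $\varepsilon>0$ and $d>0$ there is $N_0$ such that $\Pr[|X-x_N|\le\varepsilon x_N]\ge 1-N^{-d}$ for all $N\ge N_0$. 2. If $\delta(N)=\log N+\omega(1)$, then $X=0$ (that is, $Q(D)$ is empty) almost surely; that is, for every $\eta>0$ there is $N_0$ such that $\Pr[X=0]\ge 1-\eta$ for all $N\ge N_0$. -/

import Mathlib

open MeasureTheory ProbabilityTheory

noncomputable section

/-- A join query `⋈_R R(A_R)` whose schema is the (finite) type `σ` of its relation names; the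
relation name `R` has the finite set `attr R` of attributes. Different relation names may have the
same attributes. A natural join is idempotent, so repeated atoms need not be recorded. -/
structure JoinQuery (α σ : Type*) where
  /-- The set `A_R` of attributes of the relation name `R`. -/
  attr : σ → Finset α

/-- The `A`-tuples over the domain `V`. -/
abbrev Tup {α : Type*} (A : Finset α) (V : Type*) : Type _ := A → V

namespace JoinQuery

variable {α σ : Type*}

/-- The database instances with domain `V`: an `A_R`-relation for every relation name `R`. -/
abbrev Instance (Q : JoinQuery α σ) (V : Type*) : Type _ :=
  (R : σ) → Set (Tup (Q.attr R) V)

section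

variable [DecidableEq α] [Fintype σ]

/-- The set of attributes of the query, `A_Q = ⋃_R A_R`. -/
def attributes (Q : JoinQuery α σ) : Finset α := Finset.univ.biUnion Q.attr

theorem attr_subset (Q : JoinQuery α σ) (R : σ) : Q.attr R ⊆ Q.attributes :=
  Finset.subset_biUnion_of_mem Q.attr (Finset.mem_univ R)

/-- The answer `Q(D)`: all `A_Q`-tuples whose projection to `A_R` lies in `R(D)` for every `R`. -/
def answer (Q : JoinQuery α σ) {V : Type*} (D : Q.Instance V) : Set (Tup Q.attributes V) :=
  {t | ∀ R, Finset.restrict₂ (π := fun _ => V) (Q.attr_subset R) t ∈ D R}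

/-- The density `δ(Q[B], w) = |B|⁻¹ ∑_R w_R`, the sum over those relation names `R` all of whose
attributes are in `B`. -/
def density (Q : JoinQuery α σ) (w : σ → ℝ) (B : Finset α) : ℝ :=
  (∑ R with Q.attr R ⊆ B, w R) / (B.card : ℝ)

/-- The maximum density `max {δ(Q[B], w) : ∅ ≠ B ⊆ A_Q}`; the maximum exists when the query has at
least one attribute. -/
def maxDensity (Q : JoinQuery α σ) (hQ : Q.attributes.Nonempty) (w : σ → ℝ) : ℝ :=
  (Q.attributes.powerset.filter Finset.Nonempty).sup'
    ⟨Q.attributes, by simpa using hQ⟩ (Q.density w)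

end

/-- The random database model `𝒟(N, p)`, as a measure on the instances with domain of size `N`:
every tuple over the domain is placed in `R(D)` with probability `p R`, independently for all
relation names and all tuples. -/
def randomInstance [Fintype σ] (Q : JoinQuery α σ) (N : ℕ) (p : σ → Set.Ioo (0 : ℝ) 1) :
    Measure (Q.Instance (Fin N)) :=
  Measure.pi fun R =>
    setBernoulli Set.univ (Set.inclusion Set.Ioo_subset_Icc_self (p R) : unitInterval)

end JoinQuery

/-- `f = ω(g)`: for every constant `C > 0`, `f N > C * g N` for all large enough `N`. -/
def IsLittleOmega (f g : ℕ → ℝ) : Prop :=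
  ∀ C : ℝ, 0 < C → ∃ N₀ : ℕ, ∀ N ≥ N₀, C * g N < f N

/-- The events `S N` of the probability spaces `(Ω N, P N)` hold almost surely, in the asymptotic
sense: for every `η > 0`, `S N` has probability at least `1 - η` for all large enough `N`. -/
def HoldsAlmostSurely {Ω : ℕ → Type*} [∀ N, MeasurableSpace (Ω N)] (P : ∀ N, Measure (Ω N))
    (S : ∀ N, Set (Ω N)) : Prop :=
  ∀ η : ℝ, 0 < η → ∃ N₀ : ℕ, ∀ N ≥ N₀, 1 - η ≤ (P N).real (S N)

/-- `X ∼ x` polynomially almost surely: for all `ε > 0` and `d > 0`,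
`ℙ(|X - x| ≤ ε x) ≥ 1 - N ^ (-d)` for all large enough `N`. -/
def SimPolynomiallyAlmostSurely {Ω : ℕ → Type*} [∀ N, MeasurableSpace (Ω N)]
    (P : ∀ N, Measure (Ω N)) (X : ∀ N, Ω N → ℝ) (x : ℕ → ℝ) : Prop :=
  ∀ ε d : ℝ, 0 < ε → 0 < d → ∃ N₀ : ℕ, ∀ N ≥ N₀,
    1 - (N : ℝ) ^ (-d) ≤ (P N).real {D | |X N D - x N| ≤ ε * x N}

end

/-! ### Random subsets of a finite type -/

/-! View the instance as a random set of facts `(R, u)`, so that `X` counts the tuples `t` whose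
facts are all present. Put `a = 2 ^ δ`. By definition of `δ`, `∏ (p R)⁻¹` over `attr R ⊆ B` is at
most `a ^ |B|`. If `t` agrees with earlier tuples `L` exactly on the coordinates `B`, a fact of `t`
already needed by `L` has its attributes in `B`, so the new facts cost at most `(∏ p R) * a ^ |B|`.
This bound factorises over coordinates (`prod_facts_sdiff_biUnion_le`).

Upper tail: iterated conditioning gives `E X ^ K ≤ (x * exp (n K a / N)) ^ K` for `x = N ^ n * ∏ p
R`; Markov with `K` of order `log N` suffices, as `a / N ≤ 1 / log² N`. Lower tail: Janson's
inequality, where the tuples sharing a fact with a fixed one contribute at most `x * 3 n a / N`, so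
the error is `exp (-Ω(log² N))`.

Emptiness is a first moment bound for a densest `B`: every answer restricts to a `B`-tuple with all
its facts present, and `(N / 2 ^ δ) ^ |B|` such tuples are expected. -/

namespace RandomSubset

open Finset

variable {U : Type*} [Fintype U] [DecidableEq U]

/-- The probability that the random subset, to which each `x` belongs independently with
probability `q x`, equals `F`. -/
noncomputable def weight (q : U → ℝ) (F : Finset U) : ℝ :=
  ∏ x, if x ∈ F then q x else 1 - q x

/-- The expectation of `f` under the random subset with inclusion probabilities `q`. -/
noncomputable def expect (q : U → ℝ) (f : Finset U → ℝ) : ℝ :=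
  ∑ F, weight q F * f F

variable {q : U → ℝ}

theorem weight_nonneg (h0 : ∀ x, 0 ≤ q x) (h1 : ∀ x, q x ≤ 1) (F : Finset U) :
    0 ≤ weight q F := by
  refine prod_nonneg fun x _ => ?_
  split_ifs
  · exact h0 x
  · linarith [h1 x]

theorem expect_mono (h0 : ∀ x, 0 ≤ q x) (h1 : ∀ x, q x ≤ 1) {f g : Finset U → ℝ}
    (h : ∀ F, f F ≤ g F) : expect q f ≤ expect q g :=
  sum_le_sum fun F _ => mul_le_mul_of_nonneg_left (h F) (weight_nonneg h0 h1 F)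

theorem expect_nonneg (h0 : ∀ x, 0 ≤ q x) (h1 : ∀ x, q x ≤ 1) {f : Finset U → ℝ}
    (h : ∀ F, 0 ≤ f F) : 0 ≤ expect q f :=
  sum_nonneg fun F _ => mul_nonneg (weight_nonneg h0 h1 F) (h F)

theorem expect_sum {T : Type*} (s : Finset T) (f : T → Finset U → ℝ) :
    expect q (fun F => ∑ t ∈ s, f t F) = ∑ t ∈ s, expect q (f t) := by
  simp only [expect, mul_sum]
  exact sum_comm

theorem expect_const_mul (c : ℝ) (f : Finset U → ℝ) :
    expect q (fun F => c * f F) = c * expect q f := by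
  simp only [expect, mul_sum]
  exact sum_congr rfl fun F _ => by ring

theorem expect_sub (f g : Finset U → ℝ) :
    expect q (fun F => f F - g F) = expect q f - expect q g := by
  simp only [expect, mul_sub, sum_sub_distrib]

theorem expect_const (q : U → ℝ) (c : ℝ) : expect q (fun _ => c) = c := by
  have h : ∏ x : U, (q x + (1 - q x)) = ∑ F, weight q F := by
    rw [Finset.prod_add, powerset_univ]
    refine sum_congr rfl fun F _ => ?_
    rw [weight, prod_ite]
    congr 2 <;> ext x <;> simp
  rw [expect, ← sum_mul, ← h]
  simp

/-- Pair each `F` avoiding `x` with `insert x F`: their weights are `1 - q x` and `q x` times a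
common factor. -/
theorem expect_mem_mul (q : U → ℝ) (x : U) (f : Finset U → ℝ) :
    expect q (fun F => if x ∈ F then f F else 0) = q x * expect q (fun F => f (insert x F)) := by
  have hx : x ∉ univ.erase x := by simp
  have key : ∀ g : Finset U → ℝ, ∑ F, g F =
      ∑ F ∈ (univ.erase x).powerset, g F + ∑ F ∈ (univ.erase x).powerset, g (insert x F) := by
    intro g
    rw [← sum_powerset_insert hx, insert_erase (mem_univ x), powerset_univ]
  rw [expect, expect, key, key, ← sum_add_distrib, ← sum_add_distrib, mul_sum]
  refine sum_congr rfl fun F hF => ?_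
  have hxF : x ∉ F := fun h => hx (mem_powerset.1 hF h)
  have h1 : weight q F = (1 - q x) * ∏ y ∈ univ.erase x, if y ∈ F then q y else 1 - q y := by
    rw [weight, ← mul_prod_erase univ _ (mem_univ x), if_neg hxF]
  have h2 : weight q (insert x F) =
      q x * ∏ y ∈ univ.erase x, if y ∈ F then q y else 1 - q y := by
    rw [weight, ← mul_prod_erase univ _ (mem_univ x), if_pos (mem_insert_self x F)]
    congr 1
    refine prod_congr rfl fun y hy => ?_
    simp [ne_of_mem_erase hy]
  simp only [hxF, if_false, mem_insert_self, if_true, insert_idem, h1, h2]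
  ring

/-- Conditioning the random subset on containing `S` amounts to adding `S` to it. -/
theorem expect_subset_mul (q : U → ℝ) (S : Finset U) (f : Finset U → ℝ) :
    expect q (fun F => if S ⊆ F then f F else 0) =
      (∏ x ∈ S, q x) * expect q (fun F => f (F ∪ S)) := by
  induction S using Finset.induction_on generalizing f with
  | empty => simp
  | insert x S hx ih =>
    have h : (fun F => if insert x S ⊆ F then f F else 0) =
        fun F => if x ∈ F then (if S ⊆ F then f F else 0) else 0 := by
      funext F
      simp only [insert_subset_iff]
      split_ifs <;> simp_all
    have h' : (fun F => if S ⊆ insert x F then f (insert x F) else 0) =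
        fun F => if S ⊆ F then f (insert x F) else 0 := by
      funext F
      simp only [subset_insert_iff_of_notMem hx]
    rw [h, expect_mem_mul, h', ih, prod_insert hx, mul_assoc]
    simp only [union_insert]

theorem expect_subset (q : U → ℝ) (S : Finset U) :
    expect q (fun F => if S ⊆ F then 1 else 0) = ∏ x ∈ S, q x := by
  rw [expect_subset_mul, expect_const, mul_one]

open scoped Classical in
/-- The probability that the random subset satisfies `A`. -/
noncomputable def prob (q : U → ℝ) (A : Finset U → Prop) : ℝ :=
  expect q fun F => if A F then 1 else 0

theorem prob_le_of_expect_le (h0 : ∀ x, 0 ≤ q x) (h1 : ∀ x, q x ≤ 1) {A : Finset U → Prop}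
    {f : Finset U → ℝ} {c b : ℝ} (hc : 0 < c) (hf : ∀ F, 0 ≤ f F)
    (hA : ∀ F, A F → c ≤ f F) (hb : expect q f ≤ b) : prob q A ≤ b / c := by
  rw [le_div_iff₀' hc, prob, ← expect_const_mul]
  refine (expect_mono h0 h1 fun F => ?_).trans hb
  split_ifs with h
  · simpa using hA F h
  · simpa using hf F

theorem one_sub_prob_sub_prob_le (h0 : ∀ x, 0 ≤ q x) (h1 : ∀ x, q x ≤ 1)
    {A B C : Finset U → Prop} (h : ∀ F, ¬ A F → ¬ B F → C F) :
    1 - prob q A - prob q B ≤ prob q C := by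
  classical
  have e : 1 - prob q A - prob q B = expect q
      fun F => 1 - (if A F then 1 else 0) - if B F then 1 else 0 := by
    rw [expect_sub, expect_sub, expect_const]
    rfl
  rw [e]
  refine expect_mono h0 h1 fun F => ?_
  have := h F
  split_ifs <;> first | tauto | norm_num

theorem one_sub_prob (q : U → ℝ) (A : Finset U → Prop) :
    1 - prob q A = prob q fun F => ¬ A F := by
  classical
  have e : 1 - prob q A = expect q fun F => 1 - if A F then 1 else 0 := by
    rw [expect_sub, expect_const]
    rfl
  rw [e, prob]
  congr 1
  funext F
  by_cases h : A F <;> simp [h]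

/-! ### Moments, Janson's inequality and the first moment bound. -/

section Count

theorem sdiff_subset_iff_subset_union {A B C : Finset U} : A \ B ⊆ C ↔ A ⊆ C ∪ B := by
  rw [union_comm]
  exact sdiff_le_iff

variable {T : Type*} [Fintype T]

/-- The number of members of the family `S` contained in `F`. -/
noncomputable def count (S : T → Finset U) (F : Finset U) : ℝ :=
  ∑ t, if S t ⊆ F then 1 else 0

omit [Fintype U] in
theorem count_nonneg (S : T → Finset U) (F : Finset U) : 0 ≤ count S F :=
  sum_nonneg fun t _ => by split_ifs <;> norm_num

theorem expect_count (q : U → ℝ) (S : T → Finset U) :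
    expect q (count S) = ∑ t, ∏ x ∈ S t, q x := by
  rw [← sum_congr rfl fun t _ => expect_subset q (S t), ← expect_sum]
  rfl

/-- Trades one factor `count` for conditioning on one more member; the set `C` of elements already
forced lets this be iterated. -/
theorem expect_count_mul (q : U → ℝ) (S : T → Finset U) (C : Finset U) (f : Finset U → ℝ) :
    expect q (fun F => count S (F ∪ C) * f F) =
      ∑ t, (∏ x ∈ S t \ C, q x) * expect q (fun F => f (F ∪ (S t \ C))) := by
  have h : (fun F => count S (F ∪ C) * f F) =
      fun F => ∑ t, if S t \ C ⊆ F then f F else 0 := by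
    funext F
    rw [count, sum_mul]
    refine sum_congr rfl fun t _ => ?_
    simp only [sdiff_subset_iff_subset_union, ite_mul, one_mul, zero_mul]
  rw [h, expect_sum]
  exact sum_congr rfl fun t _ => expect_subset_mul q _ f

/-- Bound for the moments of the number of members of a family that the random subset contains. -/
theorem expect_count_pow_le [DecidableEq T] (h0 : ∀ x, 0 ≤ q x)
    (S : T → Finset U) {K : ℕ} {M : ℝ}
    (hM : ∀ L : Finset T, L.card ≤ K → ∑ t, ∏ x ∈ S t \ L.biUnion S, q x ≤ M) (k : ℕ)
    (L : Finset T) (hL : L.card + k ≤ K) :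
    expect q (fun F => count S (F ∪ L.biUnion S) ^ k) ≤ M ^ k := by
  induction k generalizing L with
  | zero => simp [expect_const]
  | succ k ih =>
    have hML := hM L (by omega)
    have hM0 : 0 ≤ M := (sum_nonneg fun t _ => prod_nonneg fun x _ => h0 x).trans hML
    simp only [pow_succ']
    rw [expect_count_mul]
    calc _ ≤ ∑ t, (∏ x ∈ S t \ L.biUnion S, q x) * M ^ k := by
          refine sum_le_sum fun t _ => mul_le_mul_of_nonneg_left ?_ (prod_nonneg fun x _ => h0 x)
          -- Conditioning on `t` adds it to `L`, while the exponent drops by one, so the budget `K`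
          -- is respected.
          have := ih (insert t L) (by have := card_insert_le t L; omega)
          simpa only [biUnion_insert, union_assoc, sdiff_union_self_eq_union,
            union_comm (L.biUnion S), union_left_comm] using this
      _ ≤ M * M ^ k := by
          rw [← sum_mul]
          exact mul_le_mul_of_nonneg_right hML (pow_nonneg hM0 k)

theorem prob_count_upper_tail [DecidableEq T] (h0 : ∀ x, 0 ≤ q x) (h1 : ∀ x, q x ≤ 1)
    (S : T → Finset U) {K : ℕ} {M y : ℝ} (hy : 0 < y)
    (hM : ∀ L : Finset T, L.card ≤ K → ∑ t, ∏ x ∈ S t \ L.biUnion S, q x ≤ M) :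
    prob q (fun F => y < count S F) ≤ (M / y) ^ K := by
  rw [div_pow]
  refine prob_le_of_expect_le h0 h1 (pow_pos hy K) (fun F => pow_nonneg (count_nonneg S F) K)
    (fun F hF => pow_le_pow_left₀ hy.le hF.le K) ?_
  simpa using expect_count_pow_le h0 S hM K ∅ (by simp)

/-- The differential inequality `-Ψ' ≥ m (1 - s D) Ψ` for the Laplace transform `Ψ`. Conditioning on
`S t ⊆ F` raises the count only through members meeting `S t`, and `exp (-s Z) ≥ 1 - s Z`. -/
theorem le_expect_count_mul_exp (h0 : ∀ x, 0 ≤ q x) (h1 : ∀ x, q x ≤ 1)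
    (S : T → Finset U) {D s : ℝ} (hs : 0 ≤ s)
    (hD : ∀ t, ∑ t' with ¬ Disjoint (S t') (S t), ∏ x ∈ S t' \ S t, q x ≤ D) :
    (∑ t, ∏ x ∈ S t, q x) * (1 - s * D) * expect q (fun F => Real.exp (-s * count S F)) ≤
      expect q (fun F => count S F * Real.exp (-s * count S F)) := by
  set Ψ := expect q (fun F => Real.exp (-s * count S F)) with hΨ
  have hcount : ∀ F G : Finset U, F ⊆ G → count S F ≤ count S G := by
    intro F G h
    refine sum_le_sum fun t _ => ?_
    by_cases hF : S t ⊆ F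
    · simp [hF, hF.trans h]
    · simp only [hF, if_false]
      split_ifs <;> norm_num
  have h := expect_count_mul q S ∅ (fun F => Real.exp (-s * count S F))
  simp only [union_empty, sdiff_empty] at h
  rw [h, mul_assoc, sum_mul]
  refine sum_le_sum fun t _ => mul_le_mul_of_nonneg_left ?_ (prod_nonneg fun x _ => h0 x)
  set Z : Finset U → ℝ := fun F =>
    ∑ t' with ¬ Disjoint (S t') (S t), if S t' \ S t ⊆ F then 1 else 0 with hZ
  have hZle : ∀ F, count S (F ∪ S t) ≤ count S F + Z F := by
    intro F
    simp only [hZ, count, sum_filter, ← sum_add_distrib]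
    refine sum_le_sum fun t' _ => ?_
    by_cases hd : Disjoint (S t') (S t)
    · have : S t' ⊆ F ∪ S t ↔ S t' ⊆ F := by
        rw [← sdiff_subset_iff_subset_union, sdiff_eq_self_of_disjoint hd]
      simp [hd, this]
    · simp only [hd, not_false_eq_true, if_true, sdiff_subset_iff_subset_union]
      split_ifs <;> norm_num
  have hpt : ∀ F, Real.exp (-s * count S F) - s * (Z F * Real.exp (-s * count S F)) ≤
      Real.exp (-s * count S (F ∪ S t)) := by
    intro F
    calc _ = Real.exp (-s * count S F) * (-s * Z F + 1) := by ring
      _ ≤ Real.exp (-s * count S F) * Real.exp (-s * Z F) :=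
          mul_le_mul_of_nonneg_left (Real.add_one_le_exp _) (Real.exp_pos _).le
      _ = Real.exp (-s * (count S F + Z F)) := by rw [← Real.exp_add]; ring_nf
      _ ≤ _ := Real.exp_le_exp.2 (by nlinarith [hZle F])
  -- Instead of a correlation inequality: forcing `S t' \ S t` into `F` can only raise the count,
  -- hence lower the exponential.
  have hZE : expect q (fun F => Z F * Real.exp (-s * count S F)) ≤ D * Ψ := by
    have e : (fun F => Z F * Real.exp (-s * count S F)) = fun F =>
        ∑ t' with ¬ Disjoint (S t') (S t),
          if S t' \ S t ⊆ F then Real.exp (-s * count S F) else 0 := by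
      funext F
      simp only [hZ, sum_mul, ite_mul, one_mul, zero_mul]
    rw [e, expect_sum]
    calc _ ≤ ∑ t' with ¬ Disjoint (S t') (S t), (∏ x ∈ S t' \ S t, q x) * Ψ := by
          refine sum_le_sum fun t' _ => ?_
          rw [expect_subset_mul]
          refine mul_le_mul_of_nonneg_left (expect_mono h0 h1 fun F => ?_)
            (prod_nonneg fun x _ => h0 x)
          exact Real.exp_le_exp.2 (by nlinarith [hcount F _ (subset_union_left (s₂ := S t' \ S t))])
      _ ≤ D * Ψ := by
          rw [← sum_mul]
          exact mul_le_mul_of_nonneg_right (hD t)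
            (expect_nonneg h0 h1 fun F => (Real.exp_pos _).le)
  refine le_trans ?_ (expect_mono h0 h1 hpt)
  rw [expect_sub, expect_const_mul, ← hΨ]
  nlinarith [mul_le_mul_of_nonneg_left hZE hs]

/-- Janson's inequality, for the Laplace transform. -/
theorem expect_exp_neg_count_le (h0 : ∀ x, 0 ≤ q x) (h1 : ∀ x, q x ≤ 1)
    (S : T → Finset U) {D s : ℝ} (hs : 0 ≤ s)
    (hD : ∀ t, ∑ t' with ¬ Disjoint (S t') (S t), ∏ x ∈ S t' \ S t, q x ≤ D) :
    expect q (fun F => Real.exp (-s * count S F)) ≤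
      Real.exp (-s * (∑ t, ∏ x ∈ S t, q x) + s ^ 2 * (∑ t, ∏ x ∈ S t, q x) * D / 2) := by
  set m := ∑ t, ∏ x ∈ S t, q x with hm
  set Ψ : ℝ → ℝ := fun u => expect q (fun F => Real.exp (-u * count S F)) with hΨ
  set Φ : ℝ → ℝ := fun u => expect q (fun F => count S F * Real.exp (-u * count S F)) with hΦ
  have hder : ∀ u, HasDerivAt Ψ (-Φ u) u := by
    intro u
    have : -Φ u = ∑ F, weight q F * (Real.exp (-u * count S F) * (-1 * count S F)) := by
      simp only [hΦ, expect, ← sum_neg_distrib]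
      exact sum_congr rfl fun F _ => by ring
    rw [this]
    refine HasDerivAt.fun_sum fun F _ => ?_
    exact (((hasDerivAt_id u).neg.mul_const _).exp).const_mul _
  -- The integrating factor turns the differential inequality into monotonicity on `u ≥ 0`.
  have hder2 : ∀ u, HasDerivAt (fun u => Ψ u * Real.exp (u * m - u ^ 2 * (m * D / 2)))
      (Real.exp (u * m - u ^ 2 * (m * D / 2)) * (m * (1 - u * D) * Ψ u - Φ u)) u := by
    intro u
    have h := (hder u).mul ((((hasDerivAt_id u).mul_const m).sub
      ((hasDerivAt_pow 2 u).mul_const (m * D / 2))).exp)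
    refine HasDerivAt.congr_deriv h ?_
    simp only [Pi.sub_apply, id]
    push_cast
    ring
  have hanti : AntitoneOn (fun u => Ψ u * Real.exp (u * m - u ^ 2 * (m * D / 2)))
      (Set.Ici 0) := by
    refine antitoneOn_of_deriv_nonpos (convex_Ici 0)
      (fun u _ => (hder2 u).continuousAt.continuousWithinAt)
      (fun u _ => (hder2 u).differentiableAt.differentiableWithinAt) fun u hu => ?_
    rw [interior_Ici] at hu
    rw [(hder2 u).deriv]
    exact mul_nonpos_of_nonneg_of_nonpos (Real.exp_pos _).le
      (sub_nonpos.2 (le_expect_count_mul_exp h0 h1 S (le_of_lt hu) hD))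
  have h := hanti (Set.mem_Ici.2 le_rfl) (Set.mem_Ici.2 hs) hs
  have h00 : Ψ 0 = 1 := by simp [hΨ, expect_const]
  simp only [h00, zero_mul, zero_pow two_ne_zero, sub_zero, Real.exp_zero, mul_one] at h
  calc Ψ s = Ψ s * Real.exp (s * m - s ^ 2 * (m * D / 2)) *
        Real.exp (-s * m + s ^ 2 * m * D / 2) := by
        rw [mul_assoc, ← Real.exp_add]
        ring_nf
        simp
    _ ≤ 1 * Real.exp (-s * m + s ^ 2 * m * D / 2) :=
        mul_le_mul_of_nonneg_right h (Real.exp_pos _).le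
    _ = _ := one_mul _

theorem prob_count_lower_tail (h0 : ∀ x, 0 ≤ q x) (h1 : ∀ x, q x ≤ 1)
    (S : T → Finset U) {D ε : ℝ} (hε : 0 ≤ ε) (hD0 : 0 < D)
    (hD : ∀ t, ∑ t' with ¬ Disjoint (S t') (S t), ∏ x ∈ S t' \ S t, q x ≤ D) :
    prob q (fun F => count S F < (1 - ε) * ∑ t, ∏ x ∈ S t, q x) ≤
      Real.exp (-(ε ^ 2 * (∑ t, ∏ x ∈ S t, q x) / (2 * D))) := by
  -- `s = ε / D` minimises the Chernoff exponent `-s ε m + s² m D / 2`.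
  have hs : 0 ≤ ε / D := by positivity
  have h := prob_le_of_expect_le (A := fun F => count S F < (1 - ε) * ∑ t, ∏ x ∈ S t, q x)
    (c := Real.exp (-(ε / D) * ((1 - ε) * ∑ t, ∏ x ∈ S t, q x))) h0 h1 (Real.exp_pos _)
    (fun F => (Real.exp_pos _).le)
    (fun F hF => Real.exp_le_exp.2 (mul_le_mul_of_nonpos_left hF.le (neg_nonpos.2 hs)))
    (expect_exp_neg_count_le h0 h1 S hs hD)
  refine h.trans_eq ?_
  rw [← Real.exp_sub]
  congr 1
  field_simp
  ring

theorem prob_exists_subset_le (h0 : ∀ x, 0 ≤ q x) (h1 : ∀ x, q x ≤ 1) (S : T → Finset U) :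
    prob q (fun F => ∃ t, S t ⊆ F) ≤ ∑ t, ∏ x ∈ S t, q x := by
  have h := prob_le_of_expect_le (A := fun F => ∃ t, S t ⊆ F) (f := count S) (c := 1)
    (b := ∑ t, ∏ x ∈ S t, q x) h0 h1 one_pos (count_nonneg S) ?_ ?_
  · simpa using h
  · rintro F ⟨t, ht⟩
    refine le_trans ?_ (single_le_sum (f := fun t => if S t ⊆ F then (1 : ℝ) else 0)
      (fun t _ => by split_ifs <;> norm_num) (mem_univ t))
    simp [ht]
  · rw [expect_count]

end Count

end RandomSubset

/-! ### The random database as a random set of facts -/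

namespace JoinQuery

open Finset RandomSubset
open scoped Classical

variable {α σ : Type*} (Q : JoinQuery α σ)

/-- The facts over the domain `V`: pairs of a relation name and a tuple. -/
abbrev Fact (V : Type*) : Type _ := (R : σ) × Tup (Q.attr R) V

variable [DecidableEq α] [Fintype σ] {V : Type*} [Fintype V] [DecidableEq V]

/-- Instances correspond to sets of facts. -/
noncomputable def factsEquiv : Q.Instance V ≃ Finset (Q.Fact V) where
  toFun D := univ.filter fun x => x.2 ∈ D x.1
  invFun F R := {t | ⟨R, t⟩ ∈ F}
  left_inv D := by ext; simp
  right_inv F := by ext; simp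

theorem mem_factsEquiv {D : Q.Instance V} {x : Q.Fact V} :
    x ∈ Q.factsEquiv D ↔ x.2 ∈ D x.1 := by
  simp [factsEquiv]

instance (N : ℕ) (p : σ → Set.Ioo (0 : ℝ) 1) : IsProbabilityMeasure (Q.randomInstance N p) := by
  unfold randomInstance
  infer_instance

theorem randomInstance_real_singleton (N : ℕ) (p : σ → Set.Ioo (0 : ℝ) 1)
    (D : Q.Instance (Fin N)) :
    (Q.randomInstance N p).real {D} =
      weight (fun x : Q.Fact (Fin N) => (p x.1 : ℝ)) (Q.factsEquiv D) := by
  rw [randomInstance, measureReal_def, Measure.pi_singleton, ENNReal.toReal_prod, weight,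
    Fintype.prod_sigma]
  refine prod_congr rfl fun R _ => ?_
  rw [← measureReal_def, setBernoulli_real_singleton _ (Set.subset_univ _) Set.finite_univ]
  simp only [mem_factsEquiv]
  rw [prod_ite, prod_const, prod_const]
  congr 2
  · rw [← Set.ncard_coe_finset]
    congr 1
    ext; simp
  · rw [← Set.ncard_coe_finset]
    congr 1
    ext; simp

theorem randomInstance_real_setOf (N : ℕ) (p : σ → Set.Ioo (0 : ℝ) 1)
    (A : Finset (Q.Fact (Fin N)) → Prop) :
    (Q.randomInstance N p).real {D | A (Q.factsEquiv D)} =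
      prob (fun x : Q.Fact (Fin N) => (p x.1 : ℝ)) A := by
  have h : {D | A (Q.factsEquiv D)} =
      ((univ.filter fun D : Q.Instance (Fin N) => A (Q.factsEquiv D) :
        Finset (Q.Instance (Fin N))) : Set (Q.Instance (Fin N))) := by
    ext; simp
  rw [h, ← sum_measureReal_singleton, sum_filter, prob, RandomSubset.expect]
  refine Fintype.sum_equiv Q.factsEquiv _ _ fun D => ?_
  rw [randomInstance_real_singleton, mul_ite, mul_one, mul_zero]

/-- The facts that the tuple `t` over the attributes `B` needs. -/
noncomputable def facts {B : Finset α} (t : Tup B V) : Finset (Q.Fact V) :=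
  univ.filter fun x => ∃ h : Q.attr x.1 ⊆ B, restrict₂ (π := fun _ => V) h t = x.2

theorem mem_facts {B : Finset α} {t : Tup B V} {x : Q.Fact V} :
    x ∈ Q.facts t ↔ ∃ h : Q.attr x.1 ⊆ B, restrict₂ (π := fun _ => V) h t = x.2 := by
  simp [facts]

theorem facts_subset_iff {B : Finset α} {t : Tup B V} {F : Finset (Q.Fact V)} :
    Q.facts t ⊆ F ↔ ∀ R, ∀ h : Q.attr R ⊆ B, ⟨R, restrict₂ (π := fun _ => V) h t⟩ ∈ F := by
  constructor
  · exact fun H R h => H (Q.mem_facts.2 ⟨h, rfl⟩)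
  · rintro H ⟨R, u⟩ hu
    obtain ⟨h, hu'⟩ := Q.mem_facts.1 hu
    have hR := H R h
    rwa [show restrict₂ (π := fun _ => V) h t = u from hu'] at hR

theorem mem_answer_iff {D : Q.Instance V} {t : Tup Q.attributes V} :
    t ∈ Q.answer D ↔ Q.facts t ⊆ Q.factsEquiv D := by
  rw [facts_subset_iff]
  simp only [mem_factsEquiv, answer, Set.mem_ofPred_eq]
  exact ⟨fun H R _ => H R, fun H R => H R _⟩

/-- The number of answers of the instance with the facts `F`. -/
noncomputable def answerCount (F : Finset (Q.Fact V)) : ℝ :=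
  count (T := Tup Q.attributes V) Q.facts F

theorem ncard_answer (D : Q.Instance V) :
    ((Q.answer D).ncard : ℝ) = Q.answerCount (Q.factsEquiv D) := by
  have h : Q.answer D = (univ.filter fun t => Q.facts t ⊆ Q.factsEquiv D :
      Finset (Tup Q.attributes V)) := by
    ext t
    simp [mem_answer_iff]
  rw [h, Set.ncard_coe_finset, answerCount, count, sum_boole]

/-- Each relation name contributes at most one fact of `t`, namely its restriction. -/
theorem prod_facts_sdiff (p : σ → ℝ) {B : Finset α} (t : Tup B V) (C : Finset (Q.Fact V)) :
    ∏ x ∈ Q.facts t \ C, p x.1 = ∏ R,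
      if ∃ h : Q.attr R ⊆ B, ⟨R, restrict₂ (π := fun _ => V) h t⟩ ∉ C then p R else 1 := by
  rw [← univ_inter (Q.facts t \ C), ← prod_ite_mem, Fintype.prod_sigma]
  refine prod_congr rfl fun R _ => ?_
  by_cases h : Q.attr R ⊆ B
  · rw [prod_eq_single_of_mem (restrict₂ (π := fun _ => V) h t) (mem_univ _)]
    · simp [mem_facts, h]
    · intro u _ hu
      simp [mem_facts, h, Ne.symm hu]
  · simp [mem_facts, h]

theorem prod_facts (p : σ → ℝ) {B : Finset α} (t : Tup B V) :
    ∏ x ∈ Q.facts t, p x.1 = ∏ R with Q.attr R ⊆ B, p R := by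
  rw [← sdiff_empty (s := Q.facts t), prod_facts_sdiff, prod_filter]
  simp

theorem sum_prod_facts (p : σ → ℝ) {B : Finset α} :
    ∑ t : Tup B V, ∏ x ∈ Q.facts t, p x.1 =
      (Fintype.card V : ℝ) ^ B.card * ∏ R with Q.attr R ⊆ B, p R := by
  simp [prod_facts]

theorem prod_attributes (p : σ → ℝ) :
    ∏ R with Q.attr R ⊆ Q.attributes, p R = ∏ R, p R := by
  rw [filter_true_of_mem fun R _ => Q.attr_subset R]

/-! ### Cost of tuples that overlap given ones. -/

section Overlap

variable {p : σ → ℝ} {a : ℝ}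

theorem prod_facts_sdiff_biUnion_le (hp0 : ∀ R, 0 < p R) (hp1 : ∀ R, p R ≤ 1)
    (ha : ∀ B ⊆ Q.attributes, ∏ R with Q.attr R ⊆ B, (p R)⁻¹ ≤ a ^ B.card)
    (L : Finset (Tup Q.attributes V)) (t : Tup Q.attributes V) :
    ∏ x ∈ Q.facts t \ L.biUnion Q.facts, p x.1 ≤
      (∏ R, p R) * ∏ i, if ∃ l ∈ L, t i = l i then a else 1 := by
  set B : Finset α :=
    (univ.filter fun i : Q.attributes => ∃ l ∈ L, t i = l i).map (Function.Embedding.subtype _)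
    with hB
  have hBA : B ⊆ Q.attributes := by
    intro i hi
    simp only [hB, mem_map] at hi
    obtain ⟨j, -, rfl⟩ := hi
    exact j.2
  have h1 : ∏ i, (if ∃ l ∈ L, t i = l i then a else 1) = a ^ B.card := by
    rw [prod_ite, prod_const, prod_const_one, mul_one, hB, card_map]
  rw [h1, prod_facts_sdiff]
  refine le_trans ?_ (mul_le_mul_of_nonneg_left (ha B hBA) (prod_nonneg fun R _ => (hp0 R).le))
  rw [prod_filter, ← prod_mul_distrib]
  refine prod_le_prod (fun R _ => by split_ifs <;> simp [(hp0 R).le]) fun R _ => ?_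
  have hinv : 1 ≤ (p R)⁻¹ := (one_le_inv₀ (hp0 R)).2 (hp1 R)
  split_ifs with h h' h'
  · exact le_mul_of_one_le_right (hp0 R).le hinv
  · simp
  · rw [mul_inv_cancel₀ (hp0 R).ne']
  -- The fact of `R` is shared with some `l ∈ L`, so `t` and `l` agree on `attr R`, which forces
  -- `attr R ⊆ B`.
  · exfalso
    simp only [not_exists, not_not] at h
    have hR := h (Q.attr_subset R)
    simp only [mem_biUnion, mem_facts] at hR
    obtain ⟨l, hl, hsub, hlt⟩ := hR
    refine h' fun i hi => ?_
    simp only [hB, mem_map, mem_filter, mem_univ, true_and]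
    exact ⟨⟨i, Q.attr_subset R hi⟩, ⟨l, hl, (congrFun hlt ⟨i, hi⟩).symm⟩, rfl⟩

omit [DecidableEq V] in
theorem sum_tup_prod {A : Finset α} (g : A → V → ℝ) :
    ∑ t : Tup A V, ∏ i, g i (t i) = ∏ i, ∑ v, g i v := by
  rw [prod_univ_sum, Fintype.piFinset_univ]

/-- The sum factorises over coordinates, and in each one at most `L.card` values carry the weight
`a`. -/
theorem sum_prod_facts_sdiff_biUnion_le (hp0 : ∀ R, 0 < p R) (hp1 : ∀ R, p R ≤ 1) (ha0 : 0 ≤ a)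
    (ha : ∀ B ⊆ Q.attributes, ∏ R with Q.attr R ⊆ B, (p R)⁻¹ ≤ a ^ B.card)
    (L : Finset (Tup Q.attributes V)) :
    ∑ t : Tup Q.attributes V, ∏ x ∈ Q.facts t \ L.biUnion Q.facts, p x.1 ≤
      (∏ R, p R) * (Fintype.card V + L.card * a) ^ Q.attributes.card := by
  refine (sum_le_sum fun t _ => Q.prod_facts_sdiff_biUnion_le hp0 hp1 ha L t).trans ?_
  rw [← mul_sum]
  refine mul_le_mul_of_nonneg_left ?_ (prod_nonneg fun R _ => (hp0 R).le)
  rw [sum_tup_prod (fun i v => if ∃ l ∈ L, v = l i then a else 1)]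
  calc _ ≤ ∏ _i : Q.attributes, (Fintype.card V + L.card * a : ℝ) := by
        refine prod_le_prod (fun i _ => sum_nonneg fun v _ => by split_ifs <;> simp [ha0])
          fun i _ => ?_
        calc ∑ v, (if ∃ l ∈ L, v = l i then a else 1)
            ≤ ∑ v : V, (1 + if v ∈ L.image (fun l => l i) then a else 0) := by
              refine sum_le_sum fun v _ => ?_
              simp only [mem_image, eq_comm (a := v)]
              split_ifs <;> linarith
          _ = Fintype.card V + (L.image (fun l => l i)).card * a := by
              rw [sum_add_distrib, sum_ite_mem, univ_inter]
              simp
          _ ≤ _ := by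
              have : ((L.image (fun l => l i)).card : ℝ) ≤ L.card := by exact_mod_cast card_image_le
              nlinarith
    _ = _ := by simp

/-- A shared fact has a non-empty attribute set, so `t'` and `t` agree somewhere. The subtracted
power accounts for the tuples agreeing with `t` nowhere. -/
theorem sum_prod_facts_sdiff_le (hp0 : ∀ R, 0 < p R) (hp1 : ∀ R, p R ≤ 1) (ha1 : 1 ≤ a)
    (hQ : ∀ R, (Q.attr R).Nonempty)
    (ha : ∀ B ⊆ Q.attributes, ∏ R with Q.attr R ⊆ B, (p R)⁻¹ ≤ a ^ B.card)
    (t : Tup Q.attributes V) :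
    ∑ t' : Tup Q.attributes V with ¬ Disjoint (Q.facts t') (Q.facts t),
        ∏ x ∈ Q.facts t' \ Q.facts t, p x.1 ≤
      (∏ R, p R) * ((Fintype.card V - 1 + a) ^ Q.attributes.card -
        (Fintype.card V - 1) ^ Q.attributes.card) := by
  have hP : 0 ≤ ∏ R, p R := prod_nonneg fun R _ => (hp0 R).le
  have hsum : ∀ b : ℝ, ∑ t' : Tup Q.attributes V, ∏ i, (if t' i = t i then b else 1) =
      (Fintype.card V - 1 + b) ^ Q.attributes.card := by
    intro b
    rw [sum_tup_prod (fun i v => if v = t i then b else 1)]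
    have : ∀ i : Q.attributes, ∑ v, (if v = t i then b else 1) = Fintype.card V - 1 + b := by
      intro i
      have e : ∀ v, (if v = t i then b else 1) = 1 + if v = t i then b - 1 else 0 := by
        intro v; split_ifs <;> ring
      simp only [e, sum_add_distrib, sum_ite_eq', mem_univ, if_true, sum_const, card_univ,
        nsmul_eq_mul, mul_one]
      ring
    simp [this]
  -- At `b = 0` the product is the indicator of agreeing nowhere.
  have h0 := hsum 0
  rw [add_zero] at h0
  rw [← h0, ← hsum a, ← sum_sub_distrib, mul_sum, sum_filter]
  refine sum_le_sum fun t' _ => ?_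
  have hle : ∏ i, (if t' i = t i then (0 : ℝ) else 1) ≤ ∏ i, if t' i = t i then a else 1 :=
    prod_le_prod (fun i _ => by split_ifs <;> norm_num)
      fun i _ => by split_ifs <;> linarith
  split_ifs with h
  · exact mul_nonneg hP (sub_nonneg.2 hle)
  · obtain ⟨⟨R, u⟩, hu', hu⟩ := not_disjoint_iff.1 h
    obtain ⟨h1, h1'⟩ := Q.mem_facts.1 hu'
    obtain ⟨h2, h2'⟩ := Q.mem_facts.1 hu
    obtain ⟨i, hi⟩ := hQ R
    have hz : ∏ i, (if t' i = t i then (0 : ℝ) else 1) = 0 := by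
      refine prod_eq_zero (mem_univ ⟨i, h1 hi⟩) (if_pos ?_)
      exact congrFun (h1'.trans h2'.symm) ⟨i, hi⟩
    rw [hz, sub_zero]
    simpa using Q.prod_facts_sdiff_biUnion_le hp0 hp1 ha {t} t'

end Overlap

end JoinQuery

/-! ### Concentration and emptiness of the answer -/

namespace JoinQuery

open Finset RandomSubset Filter
open scoped Classical

variable {α σ : Type*} [DecidableEq α] [Fintype σ] (Q : JoinQuery α σ)

/-- The constant 3 is 2 from `exp y ≤ 1 + 2 y` on `[0, 1]`, plus 1 from Bernoulli's inequality and
`1 ≤ a`. -/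
theorem one_add_pow_sub_le {n : ℕ} {N a : ℝ} (hN : 1 ≤ N) (ha : 1 ≤ a) (h : n * (a / N) ≤ 1) :
    (N - 1 + a) ^ n - (N - 1) ^ n ≤ N ^ n * (3 * n * (a / N)) := by
  have hN0 : 0 < N := by linarith
  have hlow : 1 + (n : ℝ) * (-1 / N) ≤ (1 + -1 / N) ^ n := by
    refine one_add_mul_le_pow ?_ n
    rw [le_div_iff₀ hN0]
    linarith
  have hup : (1 + a / N) ^ n ≤ 1 + 2 * (n * (a / N)) := by
    have hx0 : 0 ≤ n * (a / N) := by positivity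
    calc (1 + a / N) ^ n ≤ Real.exp (a / N) ^ n :=
          pow_le_pow_left₀ (by positivity) (by linarith [Real.add_one_le_exp (a / N)]) n
      _ = Real.exp (n * (a / N)) := by rw [← Real.exp_nat_mul]
      _ ≤ 1 + 2 * (n * (a / N)) := by
          have := Real.abs_exp_sub_one_le (x := n * (a / N)) (by rwa [abs_of_nonneg hx0])
          rw [abs_of_nonneg hx0] at this
          linarith [le_abs_self (Real.exp (n * (a / N)) - 1)]
  have h1 : (N - 1) ^ n = N ^ n * (1 + -1 / N) ^ n := by
    rw [← mul_pow]; congr 1; field_simp; ring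
  have h2 : (N - 1 + a) ^ n ≤ N ^ n * (1 + a / N) ^ n := by
    rw [← mul_pow]
    refine pow_le_pow_left₀ (by linarith) ?_ n
    rw [mul_add, mul_one, mul_div_cancel₀ _ hN0.ne']
    linarith
  have h3 : (n : ℝ) * (1 / N) ≤ n * (a / N) := by gcongr
  have h4 : (n : ℝ) * (-1 / N) = -(n * (1 / N)) := by ring
  rw [h1]
  have hNn : 0 ≤ N ^ n := by positivity
  nlinarith [mul_le_mul_of_nonneg_left hlow hNn, mul_le_mul_of_nonneg_left hup hNn,
    mul_le_mul_of_nonneg_left h3 hNn]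

theorem answerCount_upper_tail {N : ℕ} (hN : 1 ≤ N) {p : σ → ℝ} (hp0 : ∀ R, 0 < p R)
    (hp1 : ∀ R, p R ≤ 1) {a : ℝ} (ha0 : 0 ≤ a)
    (ha : ∀ B ⊆ Q.attributes, ∏ R with Q.attr R ⊆ B, (p R)⁻¹ ≤ a ^ B.card)
    {ε : ℝ} (hε : 0 < ε) (K : ℕ) :
    prob (fun x : Q.Fact (Fin N) => p x.1)
      (fun F => (1 + ε) * ((N : ℝ) ^ Q.attributes.card * ∏ R, p R) < Q.answerCount F) ≤
      (Real.exp (Q.attributes.card * (K * (a / N))) / (1 + ε)) ^ K := by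
  set n := Q.attributes.card with hn
  set P : ℝ := ∏ R, p R with hP
  have hN0 : (0 : ℝ) < N := by exact_mod_cast hN
  have hP0 : 0 < P := prod_pos fun R _ => hp0 R
  have hμ0 : 0 < (N : ℝ) ^ n * P := by positivity
  have hM : ∀ L : Finset (Tup Q.attributes (Fin N)), L.card ≤ K →
      ∑ t : Tup Q.attributes (Fin N), ∏ x ∈ Q.facts t \ L.biUnion Q.facts, p x.1 ≤
        (N : ℝ) ^ n * P * Real.exp (n * (K * (a / N))) := by
    intro L hL
    refine (Q.sum_prod_facts_sdiff_biUnion_le hp0 hp1 ha0 ha L).trans ?_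
    rw [Fintype.card_fin, ← hn, ← hP, mul_comm _ P, mul_assoc]
    refine mul_le_mul_of_nonneg_left ?_ hP0.le
    have hLK : (L.card : ℝ) ≤ K := by exact_mod_cast hL
    have hle : (N : ℝ) + L.card * a ≤ N * Real.exp (K * (a / N)) := by
      calc (N : ℝ) + L.card * a ≤ N + K * a := by gcongr
        _ = N * (K * (a / N) + 1) := by field_simp; ring
        _ ≤ _ := mul_le_mul_of_nonneg_left (Real.add_one_le_exp _) hN0.le
    rw [Real.exp_nat_mul, ← mul_pow]
    exact pow_le_pow_left₀ (by positivity) hle n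
  have hup := prob_count_upper_tail (q := fun x : Q.Fact (Fin N) => p x.1)
    (fun x => (hp0 x.1).le) (fun x => hp1 x.1) (T := Tup Q.attributes (Fin N)) Q.facts
    (K := K) (M := (N : ℝ) ^ n * P * Real.exp (n * (K * (a / N))))
    (y := (1 + ε) * ((N : ℝ) ^ n * P)) (by positivity) hM
  refine hup.trans_eq ?_
  congr 1
  field_simp

/-- In Janson's exponent the mean cancels against the overlap bound, leaving only `a / N`. -/
theorem answerCount_lower_tail (hQ : Q.attributes.Nonempty) (hne : ∀ R, (Q.attr R).Nonempty)
    {N : ℕ} (hN : 1 ≤ N) {p : σ → ℝ} (hp0 : ∀ R, 0 < p R)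
    (hp1 : ∀ R, p R ≤ 1) {a : ℝ} (ha1 : 1 ≤ a)
    (ha : ∀ B ⊆ Q.attributes, ∏ R with Q.attr R ⊆ B, (p R)⁻¹ ≤ a ^ B.card)
    (haN : Q.attributes.card * (a / N) ≤ 1) {ε : ℝ} (hε : 0 < ε) :
    prob (fun x : Q.Fact (Fin N) => p x.1)
      (fun F => Q.answerCount F < (1 - ε) * ((N : ℝ) ^ Q.attributes.card * ∏ R, p R)) ≤
      Real.exp (-(ε ^ 2 / (6 * Q.attributes.card * (a / N)))) := by
  set n := Q.attributes.card with hn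
  set P : ℝ := ∏ R, p R with hP
  have hn0 : (0 : ℝ) < n := by exact_mod_cast hQ.card_pos
  have hN0 : (0 : ℝ) < N := by exact_mod_cast hN
  have hP0 : 0 < P := prod_pos fun R _ => hp0 R
  have hD : ∀ t : Tup Q.attributes (Fin N),
      ∑ t' : Tup Q.attributes (Fin N) with ¬ Disjoint (Q.facts t') (Q.facts t),
        ∏ x ∈ Q.facts t' \ Q.facts t, p x.1 ≤ (N : ℝ) ^ n * P * (3 * n * (a / N)) := by
    intro t
    refine (Q.sum_prod_facts_sdiff_le hp0 hp1 ha1 hne ha t).trans ?_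
    rw [Fintype.card_fin, mul_comm _ P, mul_assoc]
    exact mul_le_mul_of_nonneg_left (one_add_pow_sub_le (by exact_mod_cast hN) ha1 haN) hP0.le
  have hlow := prob_count_lower_tail (q := fun x : Q.Fact (Fin N) => p x.1)
    (fun x => (hp0 x.1).le) (fun x => hp1 x.1) (T := Tup Q.attributes (Fin N)) Q.facts
    (D := (N : ℝ) ^ n * P * (3 * n * (a / N))) hε.le (by positivity) hD
  rw [Q.sum_prod_facts p, Fintype.card_fin, prod_attributes] at hlow
  refine hlow.trans_eq ?_
  congr 2
  rw [← hn, ← hP]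
  field_simp
  norm_num

/-- Concentration of the size of the answer, in terms of the ratio `a / N` of the exponential of
the maximum density to the size of the domain. -/
theorem one_sub_le_prob_answer (hQ : Q.attributes.Nonempty) (hne : ∀ R, (Q.attr R).Nonempty)
    {N : ℕ} (hN : 1 ≤ N) (p : σ → Set.Ioo (0 : ℝ) 1) {a : ℝ} (ha1 : 1 ≤ a)
    (ha : ∀ B ⊆ Q.attributes, ∏ R with Q.attr R ⊆ B, (p R : ℝ)⁻¹ ≤ a ^ B.card)
    (haN : Q.attributes.card * (a / N) ≤ 1) {ε : ℝ} (hε : 0 < ε) (K : ℕ) :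
    1 - (Real.exp (Q.attributes.card * (K * (a / N))) / (1 + ε)) ^ K -
        Real.exp (-(ε ^ 2 / (6 * Q.attributes.card * (a / N)))) ≤
      (Q.randomInstance N p).real {D | |((Q.answer D).ncard : ℝ) -
        (N : ℝ) ^ Q.attributes.card * ∏ R, (p R : ℝ)| ≤
          ε * ((N : ℝ) ^ Q.attributes.card * ∏ R, (p R : ℝ))} := by
  have hp0 : ∀ R, 0 < (p R : ℝ) := fun R => (p R).2.1
  have hp1 : ∀ R, (p R : ℝ) ≤ 1 := fun R => (p R).2.2.le
  have hup := Q.answerCount_upper_tail hN hp0 hp1 (by linarith) ha hε K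
  have hlow := Q.answerCount_lower_tail hQ hne hN hp0 hp1 ha1 ha haN hε
  simp only [ncard_answer]
  generalize (N : ℝ) ^ Q.attributes.card * ∏ R, (p R : ℝ) = m at hup hlow ⊢
  rw [Q.randomInstance_real_setOf N p fun F => |Q.answerCount F - m| ≤ ε * m]
  have hsub := one_sub_prob_sub_prob_le (q := fun x : Q.Fact (Fin N) => (p x.1 : ℝ))
    (fun x => (hp0 x.1).le) (fun x => hp1 x.1) (A := fun F => (1 + ε) * m < Q.answerCount F)
    (B := fun F => Q.answerCount F < (1 - ε) * m)
    (C := fun F => |Q.answerCount F - m| ≤ ε * m)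
    fun F hA hB => abs_le.2 ⟨by linarith, by linarith⟩
  linarith

theorem one_sub_le_prob_answer_empty {N : ℕ} (p : σ → Set.Ioo (0 : ℝ) 1) {B : Finset α}
    (hB : B ⊆ Q.attributes) :
    1 - (N : ℝ) ^ B.card * ∏ R with Q.attr R ⊆ B, (p R : ℝ) ≤
      (Q.randomInstance N p).real {D | (Q.answer D).ncard = 0} := by
  set q : Q.Fact (Fin N) → ℝ := fun x => (p x.1 : ℝ) with hq
  have h0 : ∀ x, 0 ≤ q x := fun x => (p x.1).2.1.le
  have h1 : ∀ x, q x ≤ 1 := fun x => (p x.1).2.2.le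
  have h := prob_exists_subset_le h0 h1 (T := Tup B (Fin N)) Q.facts
  simp only [hq] at h
  rw [Q.sum_prod_facts (fun R => (p R : ℝ)), Fintype.card_fin] at h
  have hset : {D : Q.Instance (Fin N) | ¬ ∃ t : Tup B (Fin N), Q.facts t ⊆ Q.factsEquiv D} ⊆
      {D | (Q.answer D).ncard = 0} := by
    intro D hD
    have : Q.answer D = ∅ := by
      refine Set.eq_empty_of_forall_notMem fun t ht => hD ⟨restrict₂ (π := fun _ => Fin N) hB t, ?_⟩
      rw [facts_subset_iff]
      intro R hR
      exact Q.mem_factsEquiv.2 (ht R)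
    simp [this]
  refine le_trans ?_ (measureReal_mono hset)
  rw [Q.randomInstance_real_setOf N p fun F => ¬ ∃ t : Tup B (Fin N), Q.facts t ⊆ F]
  rw [← one_sub_prob]
  linarith

/-! ### From densities to products of probabilities. -/

omit [Fintype σ] in
theorem prod_inv_eq_rpow (p : σ → Set.Ioo (0 : ℝ) 1) (s : Finset σ) :
    ∏ R ∈ s, (p R : ℝ)⁻¹ = 2 ^ ∑ R ∈ s, Real.logb 2 (1 / (p R : ℝ)) := by
  rw [Real.rpow_sum_of_pos two_pos]
  refine prod_congr rfl fun R _ => ?_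
  have hp := (p R).2.1
  rw [Real.rpow_logb two_pos (by norm_num) (by positivity), one_div]

theorem prod_inv_eq_rpow_density (p : σ → Set.Ioo (0 : ℝ) 1) {B : Finset α} (hB : B.Nonempty) :
    ∏ R with Q.attr R ⊆ B, (p R : ℝ)⁻¹ =
      ((2 : ℝ) ^ Q.density (fun R => Real.logb 2 (1 / (p R : ℝ))) B) ^ B.card := by
  rw [prod_inv_eq_rpow, ← Real.rpow_natCast, ← Real.rpow_mul two_pos.le, density,
    div_mul_cancel₀]
  exact_mod_cast hB.card_pos.ne'

theorem prod_inv_le_maxDensity (hQ : Q.attributes.Nonempty) (hne : ∀ R, (Q.attr R).Nonempty)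
    (p : σ → Set.Ioo (0 : ℝ) 1) {B : Finset α} (hB : B ⊆ Q.attributes) :
    ∏ R with Q.attr R ⊆ B, (p R : ℝ)⁻¹ ≤
      ((2 : ℝ) ^ Q.maxDensity hQ (fun R => Real.logb 2 (1 / (p R : ℝ)))) ^ B.card := by
  rcases B.eq_empty_or_nonempty with rfl | hB'
  -- The maximum density ignores `B = ∅`; here the product is empty because no `attr R` is.
  · have : (univ.filter fun R => Q.attr R ⊆ ∅) = ∅ :=
      filter_false_of_mem fun R _ h => (hne R).ne_empty (subset_empty.1 h)
    rw [this]
    simp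
  · rw [prod_inv_eq_rpow_density Q p hB']
    refine pow_le_pow_left₀ (by positivity) (Real.rpow_le_rpow_of_exponent_le one_le_two ?_) _
    exact le_sup' (Q.density _) (mem_filter.2 ⟨mem_powerset.2 hB, hB'⟩)

theorem maxDensity_nonneg (hQ : Q.attributes.Nonempty) (p : σ → Set.Ioo (0 : ℝ) 1) :
    0 ≤ Q.maxDensity hQ (fun R => Real.logb 2 (1 / (p R : ℝ))) := by
  refine le_trans ?_ (le_sup' (Q.density fun R => Real.logb 2 (1 / (p R : ℝ)))
    (mem_filter.2 ⟨mem_powerset_self Q.attributes, hQ⟩))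
  refine div_nonneg (sum_nonneg fun R _ => Real.logb_nonneg one_lt_two ?_) (Nat.cast_nonneg _)
  exact (one_le_div (p R).2.1).2 (p R).2.2.le

/-! ### Asymptotics in the domain size. -/

theorem eventually_affine_le_sq (A B : ℝ) {c : ℝ} (hc : 0 < c) :
    ∀ᶠ x : ℝ in atTop, A * x + B ≤ c * x ^ 2 := by
  filter_upwards [eventually_ge_atTop (max 1 ((|A| + |B|) / c))] with x hx
  have h1 : 1 ≤ x := (le_max_left _ _).trans hx
  have h2 : |A| + |B| ≤ x * c := (div_le_iff₀ hc).1 ((le_max_right _ _).trans hx)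
  nlinarith [le_abs_self A, le_abs_self B, abs_nonneg B]

/-- Half of the gain `K * log (1 + ε)` absorbs the overlap term; `K` is large enough for the other
half to reach `d * l + 1`. -/
theorem exp_div_pow_le {ε d l r : ℝ} {n K : ℕ} (hε : 0 < ε)
    (hK : 2 * (d * l + 1) / Real.log (1 + ε) ≤ K) (hr : n * (K * r) ≤ Real.log (1 + ε) / 2) :
    (Real.exp (n * (K * r)) / (1 + ε)) ^ K ≤ Real.exp (-(d * l + 1)) := by
  have hg : 0 < Real.log (1 + ε) := Real.log_pos (by linarith)
  rw [div_le_iff₀ hg] at hK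
  have he : 1 + ε = Real.exp (Real.log (1 + ε)) := (Real.exp_log (by linarith)).symm
  rw [he, ← Real.exp_sub, ← Real.exp_nat_mul]
  refine Real.exp_le_exp.2 ?_
  have := mul_le_mul_of_nonneg_left hr (Nat.cast_nonneg (α := ℝ) K)
  linarith

theorem two_rpow_div_le {N : ℕ} {δ : ℝ} (hl : 1 ≤ Real.log N)
    (h : 2 * Real.logb 2 (Real.logb 2 N) < Real.logb 2 N - δ) :
    2 ^ δ / (N : ℝ) ≤ 1 / Real.log N ^ 2 := by
  have hN : (0 : ℝ) < N := by
    rcases Nat.eq_zero_or_pos N with rfl | h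
    · norm_num at hl
    · exact_mod_cast h
  have hlog2 : Real.log 2 ≤ 1 := by linarith [Real.log_two_lt_d9]
  have hlog2' : 0 < Real.log 2 := Real.log_pos one_lt_two
  have hle : Real.log N ≤ Real.logb 2 N := by
    rw [Real.logb, le_div_iff₀ hlog2']
    nlinarith
  have hb : 0 < Real.logb 2 N := by linarith
  calc (2 : ℝ) ^ δ / N ≤ 2 ^ (Real.logb 2 N - 2 * Real.logb 2 (Real.logb 2 N)) / N := by
        gcongr
        · norm_num
        · linarith
    _ = 1 / Real.logb 2 N ^ 2 := by
        rw [Real.rpow_sub two_pos, Real.rpow_logb two_pos (by norm_num) hN, mul_comm 2,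
          Real.rpow_mul two_pos.le, Real.rpow_logb two_pos (by norm_num) hb, Real.rpow_two]
        field_simp
    _ ≤ 1 / Real.log N ^ 2 := by gcongr

theorem simPolynomiallyAlmostSurely_ncard_answer (hQ : Q.attributes.Nonempty)
    (hne : ∀ R, (Q.attr R).Nonempty) (p : σ → ℕ → Set.Ioo (0 : ℝ) 1)
    (h : ∀ᶠ N : ℕ in atTop, 2 * Real.logb 2 (Real.logb 2 N) <
      Real.logb 2 N - Q.maxDensity hQ fun R => Real.logb 2 (1 / (p R N : ℝ))) :
    SimPolynomiallyAlmostSurely (fun N => Q.randomInstance N fun R => p R N)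
      (fun _ D => ((Q.answer D).ncard : ℝ))
      (fun N => (N : ℝ) ^ Q.attributes.card * ∏ R, (p R N : ℝ)) := by
  intro ε d hε hd
  rw [← eventually_atTop]
  set n := Q.attributes.card with hn
  have hn0 : (0 : ℝ) < n := by exact_mod_cast hQ.card_pos
  set g := Real.log (1 + ε) with hg
  have hg0 : 0 < g := Real.log_pos (by linarith)
  have hlog : Tendsto (fun N : ℕ => Real.log N) atTop atTop :=
    Real.tendsto_log_atTop.comp tendsto_natCast_atTop_atTop
  filter_upwards [h, eventually_ge_atTop 1, hlog.eventually (eventually_ge_atTop 1),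
    hlog.eventually (eventually_affine_le_sq (n * (2 * d / g)) (n * (2 / g + 1)) (half_pos hg0)),
    hlog.eventually (eventually_affine_le_sq d 1 (show 0 < ε ^ 2 / (6 * n) by positivity)),
    hlog.eventually (eventually_affine_le_sq 0 n one_pos)] with N hN hN1 hl hA hB hC
  set l := Real.log N with hl_def
  set a : ℝ := 2 ^ Q.maxDensity hQ fun R => Real.logb 2 (1 / (p R N : ℝ)) with ha_def
  have ha1 : 1 ≤ a := Real.one_le_rpow one_le_two (Q.maxDensity_nonneg hQ fun R => p R N)
  have hN0 : (0 : ℝ) < N := by exact_mod_cast hN1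
  have hl2 : 0 < l ^ 2 := by positivity
  have hr : a / N ≤ 1 / l ^ 2 := two_rpow_div_le hl hN
  have hr0 : 0 < a / N := by positivity
  have hnr : n * (a / N) ≤ 1 := by
    calc n * (a / N) ≤ n * (1 / l ^ 2) := by gcongr
      _ ≤ 1 := by
        rw [mul_one_div, div_le_one hl2]
        linarith
  set K := ⌈2 * (d * l + 1) / g⌉₊ with hK
  have hK1 : 2 * (d * l + 1) / g ≤ K := Nat.le_ceil _
  have hK2 : (K : ℝ) < 2 * (d * l + 1) / g + 1 := Nat.ceil_lt_add_one (by positivity)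
  have hKr : n * (K * (a / N)) ≤ g / 2 := by
    calc n * (K * (a / N)) ≤ n * ((2 * (d * l + 1) / g + 1) * (1 / l ^ 2)) := by gcongr
      _ = (n * (2 * d / g) * l + n * (2 / g + 1)) / l ^ 2 := by field_simp; ring
      _ ≤ g / 2 := (div_le_iff₀ hl2).2 hA
  have h1 := exp_div_pow_le (d := d) (l := l) hε hK1 hKr
  have h2 : Real.exp (-(ε ^ 2 / (6 * n * (a / N)))) ≤ Real.exp (-(d * l + 1)) := by
    refine Real.exp_le_exp.2 (neg_le_neg ?_)
    calc d * l + 1 ≤ ε ^ 2 / (6 * n) * l ^ 2 := hB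
      _ = ε ^ 2 / (6 * n * (1 / l ^ 2)) := by field_simp
      _ ≤ ε ^ 2 / (6 * n * (a / N)) := by gcongr
  -- The extra 1 in the exponent gives `exp (-1) ≤ 1 / 2`, so the two tails together cost at most `N
  -- ^ (-d)`.
  have h3 : Real.exp (-(d * l + 1)) ≤ (N : ℝ) ^ (-d) / 2 := by
    rw [Real.rpow_def_of_pos hN0, neg_add, Real.exp_add, div_eq_mul_inv, ← hl_def, mul_neg,
      mul_comm l, Real.exp_neg 1]
    gcongr
    linarith [Real.add_one_le_exp (1 : ℝ)]
  have h4 := Q.one_sub_le_prob_answer hQ hne hN1 (fun R => p R N) ha1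
    (fun B hB => Q.prod_inv_le_maxDensity hQ hne (fun R => p R N) hB) hnr hε K
  refine le_trans ?_ h4
  linarith

theorem holdsAlmostSurely_answer_empty (hQ : Q.attributes.Nonempty)
    (p : σ → ℕ → Set.Ioo (0 : ℝ) 1)
    (h : ∀ C : ℝ, 0 < C → ∀ᶠ N : ℕ in atTop, C <
      (Q.maxDensity hQ fun R => Real.logb 2 (1 / (p R N : ℝ))) - Real.logb 2 N) :
    HoldsAlmostSurely (fun N => Q.randomInstance N fun R => p R N)
      (fun _ => {D | (Q.answer D).ncard = 0}) := by
  intro η hη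
  rw [← eventually_atTop]
  -- The logarithm brings the base below `η`; the 1 keeps the constant positive and the base at most
  -- 1, so the power `B.card` can be dropped.
  filter_upwards [h (max 1 (Real.logb 2 (1 / η))) (by positivity), eventually_ge_atTop 1]
    with N hN hN1
  have hN0 : (0 : ℝ) < N := by exact_mod_cast hN1
  obtain ⟨B, hB, hmax⟩ := exists_mem_eq_sup' (s := Q.attributes.powerset.filter Finset.Nonempty)
    ⟨Q.attributes, by simpa using hQ⟩ (Q.density fun R => Real.logb 2 (1 / (p R N : ℝ)))
  obtain ⟨hBA, hBne⟩ := mem_filter.1 hB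
  rw [mem_powerset] at hBA
  set w := Q.density (fun R => Real.logb 2 (1 / (p R N : ℝ))) B with hw
  have hmax' : (Q.maxDensity hQ fun R => Real.logb 2 (1 / (p R N : ℝ))) = w := hmax
  rw [hmax'] at hN
  have hprod : (N : ℝ) ^ B.card * ∏ R with Q.attr R ⊆ B, (p R N : ℝ) =
      (2 ^ (Real.logb 2 N - w)) ^ B.card := by
    have hi := Q.prod_inv_eq_rpow_density (fun R => p R N) hBne
    rw [prod_inv_distrib, inv_eq_iff_eq_inv] at hi
    rw [hi, Real.rpow_sub two_pos, Real.rpow_logb two_pos (by norm_num) hN0, div_pow,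
      div_eq_mul_inv]
  have hx : (2 : ℝ) ^ (Real.logb 2 N - w) ≤ 2 ^ (-max 1 (Real.logb 2 (1 / η))) :=
    Real.rpow_le_rpow_of_exponent_le one_le_two (by linarith)
  have hx1 : (2 : ℝ) ^ (Real.logb 2 N - w) ≤ 1 :=
    Real.rpow_le_one_of_one_le_of_nonpos one_le_two
      (by linarith [le_max_left 1 (Real.logb 2 (1 / η))])
  have hxη : (2 : ℝ) ^ (Real.logb 2 N - w) ≤ η := by
    refine hx.trans ?_
    calc (2 : ℝ) ^ (-max 1 (Real.logb 2 (1 / η))) ≤ 2 ^ (-Real.logb 2 (1 / η)) :=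
          Real.rpow_le_rpow_of_exponent_le one_le_two (neg_le_neg (le_max_right _ _))
      _ = η := by
          rw [Real.rpow_neg two_pos.le, Real.rpow_logb two_pos (by norm_num) (by positivity)]
          simp
  have hle := Q.one_sub_le_prob_answer_empty (N := N) (fun R => p R N) hBA
  refine le_trans ?_ hle
  rw [hprod]
  have := pow_le_of_le_one (by positivity) hx1 hBne.card_pos.ne'
  linarith

end JoinQuery

theorem mainTheorem8 {α σ : Type*} [DecidableEq α] [Fintype σ] (Q : JoinQuery α σ)
    (hQ : Q.attributes.Nonempty) (p : σ → ℕ → Set.Ioo (0 : ℝ) 1) (δ : ℕ → ℝ)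
    (hδ : ∀ N, δ N = Q.maxDensity hQ fun R => Real.logb 2 (1 / (p R N : ℝ))) :
    ((∀ R, (Q.attr R).Nonempty) →
      IsLittleOmega (fun N => Real.logb 2 N - δ N) (fun N => Real.logb 2 (Real.logb 2 N)) →
      SimPolynomiallyAlmostSurely (fun N => Q.randomInstance N fun R => p R N)
        (fun _ D => ((Q.answer D).ncard : ℝ))
        (fun N => (N : ℝ) ^ Q.attributes.card * ∏ R, (p R N : ℝ))) ∧
    (IsLittleOmega (fun N => δ N - Real.logb 2 N) (fun _ => 1) →
      HoldsAlmostSurely (fun N => Q.randomInstance N fun R => p R N)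
        (fun _ => {D | (Q.answer D).ncard = 0})) := by
  constructor
  · intro hne h
    refine Q.simPolynomiallyAlmostSurely_ncard_answer hQ hne p ?_
    simpa only [hδ] using Filter.eventually_atTop.2 (h 2 two_pos)
  · intro h
    refine Q.holdsAlmostSurely_answer_empty hQ p fun C hC => ?_
    simpa only [hδ, mul_one] using Filter.eventually_atTop.2 (h C hC)
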